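/- Let $1\le K<N$ be integers and $R,c>0$. There are $N$ users whose types $q_1,\dots,q_N\in[0,1]$ are drawn independently from a publicly known distribution with distribution function $F$ and a continuous density on $[0,1]$; each user knows only her own type. A user of type $q$ chooses a contribution $x\in[0,q]$ at cost $cx/q$ (read as $0$ when $q=0$). A user who contributes $0$ receives no reward; among the users with positive contributions, each of the (at most) $K$ with the largest contributions receives $R/K$, ties at the boundary being broken by a fair lottery. A symmetric pure Nash equilibrium (PNE) is a measurable map $b:[0,1]\to[0,1]$ with $0\le b(q)\le q$ such that, for every type $q\in[0,1]$, when all other users follow $b$, the contribution $b(q)$ maximizes the expected utility (expected reward minus cost) of a user of type $q$ over $[0,q]$. Let $$\beta(x)=\frac{R(N-1)}{cK}\binom{N-2}{K-1}\int_0^x t\,F(t)^{N-K-1}(1-F(t))^{K-1}\,dF(t),\qquad x\in[0,1].$$ Calibration of a function $g$ on $[0,1]$: let the first interval on which $g(x)>x$ extend from $x_1$ to $x_2$ (so $g(x)\le x$ on $[0,x_1]$, $g(x)>x$ on $(x_1,x_2)$, and $x_2=1$ or $g(x_2)\le x_2$), and choose $x_p\in(x_1,x_2]$ with $g'\ge 1$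 on $(x_1,x_p)$ and with $g'(x_p)=1$ or $x_p=1$; replace $g(x)$ by $x$ on $(x_1,x_p]$ and by $g(x)-g(x_p)+x_p$ on $(x_p,1]$. Call $h$ an output of repeated calibration of $\beta$ if it is obtained from $\beta$ by finitely many (possibly zero) calibrations and $h(x)\le x$ for all $x\in[0,1]$. Then the game has at least one symmetric PNE. More precisely: (i) the function $\beta^*(x)=\beta(x)-\max_{0\le s\le x}(\beta(s)-s)$, $x\in[0,1]$, is a symmetric PNE; (ii) every output $h$ of repeated calibration of $\beta$ is a symmetric PNE, and $h=\beta^*$ on $[0,1]$; (iii) if $\beta'(x)=1$ for only finitely many $x\in(0,1)$, then repeated calibration of $\beta$ can be carried out so as to produce an output after finitely many calibrations. -/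

import Mathlib

open MeasureTheory Set

noncomputable section

/-- `μ` is a law on `[0,1]` that has a continuous density there (equivalently: its distribution
function vanishes at `0` and is continuously differentiable on `[0,1]`). -/
def HasContinuousDensityOnUnit (μ : Measure ℝ) : Prop :=
  ∃ f : ℝ → ℝ, ContinuousOn f (Icc 0 1) ∧ (∀ t ∈ Icc (0 : ℝ) 1, 0 ≤ f t) ∧
    μ = (volume.restrict (Icc 0 1)).withDensity (fun t => ENNReal.ofReal (f t))

/-- Number of users whose contribution is strictly larger than that of user `i`. -/
def numAbove {N : ℕ} (x : Fin N → ℝ) (i : Fin N) : ℕ :=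
  (Finset.univ.filter fun j => x i < x j).card

/-- Number of users (user `i` included) whose contribution equals that of user `i`. -/
def numTied {N : ℕ} (x : Fin N → ℝ) (i : Fin N) : ℕ :=
  (Finset.univ.filter fun j => x j = x i).card

/-- Top-`K` allocation of the total reward `R`: each of the `K` largest contributors receives `R/K`.
A user who contributes nothing does not participate and receives nothing. Ties at the boundary are
broken by a fair lottery: if `a` users are strictly above user `i` and `b` users (including `i`)
are tied with her, she is selected with probability `min 1 (max 0 ((K - a) / b))`; the value below
is her expected reward. -/
def topKReward {N : ℕ} (K : ℕ) (R : ℝ) (x : Fin N → ℝ) (i : Fin N) : ℝ :=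
  if x i = 0 then 0
  else R / K * min 1 (max 0 (((K : ℝ) - numAbove x i) / numTied x i))

/-- Expected utility of user `i` when her type is `q`, she contributes `x`, the other types are
independent with law `μ`, and every other user `j` plays the strategy `σ j`. The cost is `c * x / q`
(which is `0` for the only feasible contribution `x = 0` of a user with `q = 0`). The coordinate `i`
of the random type vector `θ` plays no role, since the action of `i` is overwritten by `x`. -/
def expectedUtility {N : ℕ} (K : ℕ) (R c : ℝ) (μ : Measure ℝ) (σ : Fin N → ℝ → ℝ)
    (i : Fin N) (q x : ℝ) : ℝ :=
  (∫ θ : Fin N → ℝ, topKReward K R (Function.update (fun j => σ j (θ j)) i x) i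
      ∂(Measure.pi fun _ => μ)) - c * x / q

/-- A feasible pure strategy in the continuous action space: a measurable map on types `q ∈ [0,1]`
with values in the action set `[0,q]`. -/
def IsPureStrategy (b : ℝ → ℝ) : Prop :=
  (Measurable fun q : Icc (0 : ℝ) 1 => b q) ∧ ∀ q ∈ Icc (0 : ℝ) 1, b q ∈ Icc 0 q

/-- Pure (Bayesian) Nash equilibrium: no user, whatever her type, has a profitable feasible
deviation. -/
def IsPureNashEquilibrium {N : ℕ} (K : ℕ) (R c : ℝ) (μ : Measure ℝ) (σ : Fin N → ℝ → ℝ) : Prop :=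
  (∀ i, IsPureStrategy (σ i)) ∧
    ∀ i, ∀ q ∈ Icc (0 : ℝ) 1, ∀ x ∈ Icc (0 : ℝ) q,
      expectedUtility K R c μ σ i q x ≤ expectedUtility K R c μ σ i q (σ i q)

/-- The strategy `b`, used by all `N` users, is a symmetric pure Nash equilibrium. -/
def IsSymmetricPNE (N K : ℕ) (R c : ℝ) (μ : Measure ℝ) (b : ℝ → ℝ) : Prop :=
  IsPureNashEquilibrium (N := N) K R c μ (fun _ => b)

/-- The (possibly infeasible) strategy given by the first-order condition,
`β(x) = R (N-1) / (c K) * C(N-2, K-1) * ∫₀ˣ t F(t)^(N-K-1) (1-F(t))^(K-1) dF(t)`. -/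
def odeStrategy (N K : ℕ) (R c : ℝ) (μ : Measure ℝ) (x : ℝ) : ℝ :=
  R * ((N : ℝ) - 1) / (c * K) * ((N - 2).choose (K - 1) : ℝ) *
    ∫ t in (0 : ℝ)..x,
      t * (ProbabilityTheory.cdf μ t) ^ (N - K - 1) *
        (1 - ProbabilityTheory.cdf μ t) ^ (K - 1) ∂μ

/-- One calibration of `g`, with result `h`. The interval from `x₁` to `x₂` is the first one on which
`g x > x`; the slope of `g` is at least `1` from `x₁` to `p`, and it is equal to `1` at `p` unless
`p` is the right end `1` of the type space. The calibrated function is `x` on `(x₁, p]`, and it is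
`g` shifted down by `g p - p` to the right of `p`. -/
def CalibrationStep (g h : ℝ → ℝ) : Prop :=
  ∃ x₁ x₂ p : ℝ, 0 ≤ x₁ ∧ x₁ < p ∧ p ≤ x₂ ∧ x₂ ≤ 1 ∧
    (∀ x ∈ Icc 0 x₁, g x ≤ x) ∧ (∀ x ∈ Ioo x₁ x₂, x < g x) ∧ (x₂ = 1 ∨ g x₂ ≤ x₂) ∧
    (∀ x ∈ Ioo x₁ p, 1 ≤ deriv g x) ∧ (p = 1 ∨ deriv g p = 1) ∧
    h = fun x => if x ≤ x₁ then g x else if x ≤ p then x else g x - g p + p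

/-- `h` is the output of repeated calibration of `g`: it is obtained by finitely many
calibrations and needs no further one. -/
def IsCalibrationOutput (g h : ℝ → ℝ) : Prop :=
  Relation.ReflTransGen CalibrationStep g h ∧ ∀ x ∈ Icc (0 : ℝ) 1, h x ≤ x

end

/-! Let `w x` be the probability that fewer than `K` of the `N - 1` opponents have types above `x`.
If ties are null, a type `q` contributing `b s` earns `R / K * w s - c * b s / q`, so the
first-order condition is `b' = R / (c * K) * x * w'`. The derivative of the binomial tail
(`hasDerivAt_winProb`) makes β its solution, and under β the payoff of imitating `s` rises up to `s
= q` and falls afterwards (`winProb_sub_odeStrategy`).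

Only feasibility `b q ≤ q` can fail. Subtracting the running maximum M of `β - id` repairs it and
changes the scaled payoff of imitating `s` by `M s`. As M is nondecreasing, imitating lower types
gains nothing. If M grows between `q` and `s > q`, then β* meets the diagonal at some `t` in `(q,
s]` (`runMax_eq_or_exists`), so β* is at least `t > q` at `s` and that deviation is infeasible. Ties
are null because β* is flat only where β is, and β only where the distribution function is.

Calibration leaves the envelope unchanged (`CalibrationStep.preserves`), and a function below the
diagonal that vanishes at `0` is its own envelope; hence every output is β*. Each calibration
reaches `1` or uses up a point where β' = 1, which gives termination. -/

/-! ### The type distribution -/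

theorem HasContinuousDensityOnUnit.exists_continuous {μ : Measure ℝ}
    (hμ : HasContinuousDensityOnUnit μ) :
    ∃ f : ℝ → ℝ, Continuous f ∧ (∀ t, 0 ≤ f t) ∧
      μ = (volume.restrict (Icc 0 1)).withDensity (fun t => ENNReal.ofReal (f t)) := by
  obtain ⟨f, hf, h0, rfl⟩ := hμ
  -- Freezing the density at its endpoint values outside the interval does not change μ and makes
  -- the fundamental theorem of calculus available at every real point.
  refine ⟨IccExtend zero_le_one ((Icc (0 : ℝ) 1).domRestrict f), ?_, fun t => ?_, ?_⟩
  · exact (continuousOn_iff_continuous_domRestrict.mp hf).Icc_extend'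
  · exact h0 _ (projIcc 0 1 zero_le_one t).2
  · refine withDensity_congr_ae ?_
    filter_upwards [ae_restrict_mem measurableSet_Icc] with t ht
    rw [IccExtend_of_mem _ _ ht, domRestrict_apply]

theorem HasContinuousDensityOnUnit.ae_mem {μ : Measure ℝ} (hμ : HasContinuousDensityOnUnit μ) :
    ∀ᵐ t ∂μ, t ∈ Icc (0 : ℝ) 1 := by
  obtain ⟨f, -, -, rfl⟩ := hμ
  exact (withDensity_absolutelyContinuous _ _).ae_le (ae_restrict_mem measurableSet_Icc)

theorem HasContinuousDensityOnUnit.noAtoms {μ : Measure ℝ} (hμ : HasContinuousDensityOnUnit μ) :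
    NullSingletonClass μ := by
  obtain ⟨f, -, -, rfl⟩ := hμ
  exact ⟨fun x => withDensity_absolutelyContinuous _ _ (measure_singleton x)⟩

theorem intervalIntegral_density {f : ℝ → ℝ} (hf : Continuous f) (h0 : ∀ t, 0 ≤ f t) (g : ℝ → ℝ)
    {x : ℝ} (hx : x ∈ Icc (0 : ℝ) 1) :
    ∫ t in (0 : ℝ)..x, g t
      ∂((volume.restrict (Icc 0 1)).withDensity (fun t => ENNReal.ofReal (f t)))
      = ∫ t in (0 : ℝ)..x, f t * g t := by
  rw [intervalIntegral.integral_of_le hx.1, intervalIntegral.integral_of_le hx.1,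
    setIntegral_withDensity_eq_setIntegral_toReal_smul (by fun_prop) (by simp) _ measurableSet_Ioc,
    Measure.restrict_restrict measurableSet_Ioc,
    inter_eq_left.mpr (Ioc_subset_Icc_self.trans (Icc_subset_Icc_right hx.2))]
  simp [ENNReal.toReal_ofReal (h0 _)]

theorem measureReal_Ioc_eq_cdf_sub {μ : Measure ℝ} [IsProbabilityMeasure μ] {x y : ℝ}
    (hxy : x ≤ y) :
    μ.real (Ioc x y) = ProbabilityTheory.cdf μ y - ProbabilityTheory.cdf μ x := by
  rw [ProbabilityTheory.cdf_eq_real, ProbabilityTheory.cdf_eq_real, ← Iic_sdiff_Iic,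
    measureReal_sdiff (Iic_subset_Iic.mpr hxy) measurableSet_Iic]

theorem cdf_zero {μ : Measure ℝ} [IsProbabilityMeasure μ] (hμ : HasContinuousDensityOnUnit μ) :
    ProbabilityTheory.cdf μ 0 = 0 := by
  have := hμ.noAtoms
  rw [ProbabilityTheory.cdf_eq_real, measureReal_def, measure_eq_zero_iff_ae_notMem.mpr]
  · simp
  · filter_upwards [hμ.ae_mem, μ.ae_ne 0] with t ht h0 h
    exact h0 (le_antisymm h ht.1)

theorem cdf_one {μ : Measure ℝ} [IsProbabilityMeasure μ] (hμ : HasContinuousDensityOnUnit μ) :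
    ProbabilityTheory.cdf μ 1 = 1 := by
  rw [ProbabilityTheory.cdf_eq_real, measureReal_def, prob_compl_eq_zero_iff measurableSet_Iic |>.mp]
  · simp
  · rw [measure_eq_zero_iff_ae_notMem]
    filter_upwards [hμ.ae_mem] with t ht h
    exact h ht.2

/-- The distribution function and the first-order strategy are continuous on `[0,1]` and
differentiable in the interior, with the expected derivatives. -/
theorem exists_hasDerivAt_cdf_odeStrategy (N K : ℕ) (R c : ℝ) {μ : Measure ℝ}
    [IsProbabilityMeasure μ] (hμ : HasContinuousDensityOnUnit μ) :
    ContinuousOn (ProbabilityTheory.cdf μ) (Icc 0 1) ∧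
    ContinuousOn (odeStrategy N K R c μ) (Icc 0 1) ∧
    ∃ f : ℝ → ℝ, (∀ x, 0 ≤ f x) ∧ ∀ x ∈ Ioo (0 : ℝ) 1,
      HasDerivAt (ProbabilityTheory.cdf μ) (f x) x ∧
      HasDerivAt (odeStrategy N K R c μ)
        (R * ((N : ℝ) - 1) / (c * K) * ((N - 2).choose (K - 1) : ℝ) *
          (f x * (x * (ProbabilityTheory.cdf μ x) ^ (N - K - 1) *
            (1 - ProbabilityTheory.cdf μ x) ^ (K - 1)))) x := by
  have hNA := hμ.noAtoms
  have h00 := cdf_zero hμ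
  obtain ⟨f, hf, h0, hμf⟩ := hμ.exists_continuous
  set F := ProbabilityTheory.cdf μ with hF
  -- `G` is differentiable on the whole line but agrees with `F` only on `[0,1]`, so derivatives are
  -- transferred at interior points only.
  set G : ℝ → ℝ := fun x => ∫ t in (0 : ℝ)..x, f t with hG
  have hGd : ∀ x, HasDerivAt G (f x) x := fun x => (hf.integral_hasStrictDerivAt 0 x).hasDerivAt
  have hGc : Continuous G := continuous_iff_continuousAt.mpr fun x => (hGd x).continuousAt
  have hFG : EqOn F G (Icc 0 1) := by
    intro x hx
    have h1 := intervalIntegral_density hf h0 (fun _ => (1 : ℝ)) hx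
    rw [← hμf, intervalIntegral.integral_of_le hx.1] at h1
    simp only [mul_one, integral_const, smul_eq_mul, measureReal_restrict_apply_univ] at h1
    rw [measureReal_Ioc_eq_cdf_sub hx.1, h00, sub_zero] at h1
    exact h1
  set D : ℝ → ℝ := fun t => f t * (t * G t ^ (N - K - 1) * (1 - G t) ^ (K - 1)) with hD
  have hDc : Continuous D := by fun_prop
  set C : ℝ := R * ((N : ℝ) - 1) / (c * K) * ((N - 2).choose (K - 1) : ℝ) with hC
  set B : ℝ → ℝ := fun x => C * ∫ t in (0 : ℝ)..x, D t with hB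
  have hBd : ∀ x, HasDerivAt B (C * D x) x := fun x =>
    (hDc.integral_hasStrictDerivAt 0 x).hasDerivAt.const_mul C
  have hBc : Continuous B := continuous_iff_continuousAt.mpr fun x => (hBd x).continuousAt
  have hOB : EqOn (odeStrategy N K R c μ) B (Icc 0 1) := by
    intro x hx
    simp only [odeStrategy, hB]
    congr 1
    have h1 := intervalIntegral_density hf h0
      (fun t => t * F t ^ (N - K - 1) * (1 - F t) ^ (K - 1)) hx
    rw [← hμf] at h1
    rw [h1]
    refine intervalIntegral.integral_congr fun t ht => ?_
    rw [uIcc_of_le hx.1] at ht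
    simp only [hD, hFG ⟨ht.1, ht.2.trans hx.2⟩]
  refine ⟨hGc.continuousOn.congr hFG, hBc.continuousOn.congr hOB, f, h0, fun x hx => ?_⟩
  have hn : Icc (0 : ℝ) 1 ∈ nhds x := Icc_mem_nhds hx.1 hx.2
  refine ⟨(hGd x).congr_of_eventuallyEq (Filter.eventually_of_mem hn hFG), ?_⟩
  rw [hFG (Ioo_subset_Icc_self hx)]
  exact (hBd x).congr_of_eventuallyEq (Filter.eventually_of_mem hn hOB)

theorem odeStrategy_zero (N K : ℕ) (R c : ℝ) (μ : Measure ℝ) : odeStrategy N K R c μ 0 = 0 := by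
  simp [odeStrategy]

/-! ### The winning probability -/

/-- Probability that fewer than `K` of `n` independent opponents are above, if each of them is below
with probability `u`. -/
noncomputable def winProb (n K : ℕ) (u : ℝ) : ℝ :=
  ∑ k ∈ Finset.range K, (n.choose k : ℝ) * ((1 - u) ^ k * u ^ (n - k))

/-- A partial sum of Bernstein polynomials evaluated at `1 - u`: the derivatives telescope and a
single term survives. For `n = N - 1` it is the kernel in the integrand of β. -/
theorem hasDerivAt_winProb (n K : ℕ) (hK : 1 ≤ K) (u : ℝ) :
    HasDerivAt (winProb n K)
      (n * ((n - 1).choose (K - 1) : ℝ) * (u ^ (n - K) * (1 - u) ^ (K - 1))) u := by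
  obtain ⟨k, rfl⟩ : ∃ k, K = k + 1 := ⟨K - 1, by omega⟩
  have hpoly : Polynomial.derivative (∑ j ∈ Finset.range (k + 1), bernsteinPolynomial ℝ n j)
      = -(n : Polynomial ℝ) * bernsteinPolynomial ℝ (n - 1) k := by
    clear hK
    induction k with
    | zero => simp [bernsteinPolynomial.derivative_zero]
    | succ k ih =>
      rw [Finset.sum_range_succ, Polynomial.derivative_add, ih,
        bernsteinPolynomial.derivative_succ]
      ring
  have h1 := (Polynomial.hasDerivAt (∑ j ∈ Finset.range (k + 1), bernsteinPolynomial ℝ n j)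
    (1 - u)).comp u ((hasDerivAt_id u).const_sub 1)
  rw [hpoly] at h1
  refine (h1.congr_of_eventuallyEq (Filter.Eventually.of_forall fun v => ?_)).congr_deriv ?_
  · simp [winProb, bernsteinPolynomial, Polynomial.eval_finsetSum, mul_assoc]
  · simp [bernsteinPolynomial, Nat.sub_sub, add_comm]
    ring

theorem strictMonoOn_winProb {n K : ℕ} (hK : 1 ≤ K) (hn : K ≤ n) :
    StrictMonoOn (winProb n K) (Icc 0 1) := by
  refine strictMonoOn_of_deriv_pos (convex_Icc 0 1)
    (fun u _ => (hasDerivAt_winProb n K hK u).continuousAt.continuousWithinAt) fun u hu => ?_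
  rw [interior_Icc] at hu
  rw [(hasDerivAt_winProb n K hK u).deriv]
  have h1 : 0 < n := by omega
  have h2 : 0 < (n - 1).choose (K - 1) := Nat.choose_pos (by omega)
  have h3 := sub_pos.mpr hu.2
  have h4 := hu.1
  positivity

theorem winProb_zero {n K : ℕ} (hn : K ≤ n) : winProb n K 0 = 0 := by
  refine Finset.sum_eq_zero fun k hk => ?_
  have := Finset.mem_range.mp hk
  rw [zero_pow (by omega)]
  simp

theorem winProb_one {n K : ℕ} (hK : 1 ≤ K) : winProb n K 1 = 1 := by
  rw [winProb, Finset.sum_eq_single_of_mem 0 (Finset.mem_range.mpr hK)]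
  · simp
  · intro k _ hk
    simp [hk]

/-! ### The running maximum of `g - id` and the corrected strategy -/

/-- `max_{0 ≤ s ≤ x} (g s - s)`. -/
noncomputable def runMax (g : ℝ → ℝ) (x : ℝ) : ℝ := sSup ((fun s => g s - s) '' Icc 0 x)

/-- `g` shifted down by the running maximum of `g - id`. -/
noncomputable def envelope (g : ℝ → ℝ) (x : ℝ) : ℝ := g x - runMax g x

theorem isGreatest_runMax {g : ℝ → ℝ} (hg : ContinuousOn g (Icc 0 1)) {x : ℝ}
    (hx : x ∈ Icc (0 : ℝ) 1) : IsGreatest ((fun s => g s - s) '' Icc 0 x) (runMax g x) :=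
  (isCompact_Icc.image_of_continuousOn
    ((hg.mono (Icc_subset_Icc_right hx.2)).sub continuousOn_id)).isGreatest_sSup
      ((nonempty_Icc.mpr hx.1).image _)

theorem le_runMax {g : ℝ → ℝ} (hg : ContinuousOn g (Icc 0 1)) {s x : ℝ} (hs : 0 ≤ s) (hsx : s ≤ x)
    (hx : x ≤ 1) : g s - s ≤ runMax g x :=
  (isGreatest_runMax hg ⟨hs.trans hsx, hx⟩).2 ⟨s, ⟨hs, hsx⟩, rfl⟩

theorem exists_runMax_eq {g : ℝ → ℝ} (hg : ContinuousOn g (Icc 0 1)) {x : ℝ}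
    (hx : x ∈ Icc (0 : ℝ) 1) : ∃ s ∈ Icc 0 x, g s - s = runMax g x :=
  (isGreatest_runMax hg hx).1

theorem runMax_mono {g : ℝ → ℝ} (hg : ContinuousOn g (Icc 0 1)) {x y : ℝ} (hx : 0 ≤ x)
    (hxy : x ≤ y) (hy : y ≤ 1) : runMax g x ≤ runMax g y := by
  obtain ⟨s, hs, h⟩ := exists_runMax_eq hg ⟨hx, hxy.trans hy⟩
  rw [← h]
  exact le_runMax hg hs.1 (hs.2.trans hxy) hy

/-- Either the running maximum is constant on `[x,y]`, or the envelope touches the diagonal at some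
point of `(x,y]` after which the running maximum does not increase. -/
theorem runMax_eq_or_exists {g : ℝ → ℝ} (hg : ContinuousOn g (Icc 0 1)) {x y : ℝ} (hx : 0 ≤ x)
    (hxy : x ≤ y) (hy : y ≤ 1) :
    runMax g y = runMax g x ∨
      ∃ s ∈ Ioc x y, envelope g s = s ∧ runMax g s = runMax g y := by
  obtain ⟨s, hs, h⟩ := exists_runMax_eq hg ⟨hx.trans hxy, hy⟩
  rcases le_or_gt s x with hsx | hsx
  · left
    refine le_antisymm ?_ (runMax_mono hg hx hxy hy)
    rw [← h]
    exact le_runMax hg hs.1 hsx (hxy.trans hy)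
  · right
    have h1 : runMax g s = runMax g y :=
      le_antisymm (runMax_mono hg hs.1 hs.2 hy)
        (h ▸ le_runMax hg hs.1 le_rfl (hs.2.trans hy))
    refine ⟨s, ⟨hsx, hs.2⟩, ?_, h1⟩
    rw [envelope, h1, ← h]
    ring

theorem envelope_le {g : ℝ → ℝ} (hg : ContinuousOn g (Icc 0 1)) {x : ℝ} (hx : x ∈ Icc (0 : ℝ) 1) :
    envelope g x ≤ x := by
  have := le_runMax hg hx.1 le_rfl hx.2
  rw [envelope]
  linarith

theorem runMax_zero (g : ℝ → ℝ) : runMax g 0 = g 0 := by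
  simp [runMax]

theorem envelope_zero (g : ℝ → ℝ) : envelope g 0 = 0 := by
  rw [envelope, runMax_zero, sub_self]

section MonotoneCase

variable {g : ℝ → ℝ}

/-- While the running maximum is constant the envelope moves with `g`. Otherwise it reaches the
diagonal at some `s > x`, where it exceeds its value at `x`, and from `s` to `y` it again moves with
`g`. -/
theorem envelope_mono (hg : ContinuousOn g (Icc 0 1)) (hm : MonotoneOn g (Icc 0 1)) :
    MonotoneOn (envelope g) (Icc 0 1) := by
  intro x hx y hy hxy
  rcases runMax_eq_or_exists hg hx.1 hxy hy.2 with h | ⟨s, hs, h1, h2⟩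
  · rw [envelope, envelope, h]
    linarith [hm hx hy hxy]
  · have h3 : envelope g s ≤ envelope g y := by
      rw [envelope, envelope, h2]
      linarith [hm ⟨hx.1.trans hs.1.le, hs.2.trans hy.2⟩ hy hs.2]
    linarith [envelope_le hg hx, hs.1]

theorem envelope_nonneg (hg : ContinuousOn g (Icc 0 1)) (hm : MonotoneOn g (Icc 0 1)) {x : ℝ}
    (hx : x ∈ Icc (0 : ℝ) 1) : 0 ≤ envelope g x :=
  (envelope_zero g).ge.trans (envelope_mono hg hm ⟨le_rfl, zero_le_one⟩ hx hx.1)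

/-- Both the envelope and the running maximum are nondecreasing and they add up to `g`, so
increments of the envelope are bounded by those of `g`. -/
theorem continuousOn_envelope (hg : ContinuousOn g (Icc 0 1)) (hm : MonotoneOn g (Icc 0 1)) :
    ContinuousOn (envelope g) (Icc 0 1) := by
  have key : ∀ x ∈ Icc (0 : ℝ) 1, ∀ y ∈ Icc (0 : ℝ) 1,
      dist (envelope g y) (envelope g x) ≤ dist (g y) (g x) := by
    have aux : ∀ x ∈ Icc (0 : ℝ) 1, ∀ y ∈ Icc (0 : ℝ) 1, x ≤ y →
        dist (envelope g y) (envelope g x) ≤ dist (g y) (g x) := by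
      intro x hx y hy hxy
      have h1 := envelope_mono hg hm hx hy hxy
      have h2 := runMax_mono hg hx.1 hxy hy.2
      rw [Real.dist_eq, Real.dist_eq, abs_of_nonneg (sub_nonneg.mpr h1)]
      refine le_trans ?_ (le_abs_self _)
      rw [envelope, envelope]
      linarith
    intro x hx y hy
    rcases le_total x y with h | h
    · exact aux x hx y hy h
    · rw [dist_comm, dist_comm (g y)]
      exact aux y hy x hx h
  intro x hx
  rw [ContinuousWithinAt, tendsto_iff_dist_tendsto_zero]
  refine squeeze_zero' (Filter.Eventually.of_forall fun _ => dist_nonneg) ?_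
    (tendsto_iff_dist_tendsto_zero.mp (hg x hx))
  filter_upwards [self_mem_nhdsWithin] with y hy using key x hx y hy

/-- Touching the diagonal at some `s > x` would make the envelope strictly larger at `y` than at
`x`, so on a flat piece the running maximum is constant. This is what later excludes ties. -/
theorem eq_of_envelope_eq (hg : ContinuousOn g (Icc 0 1)) (hm : MonotoneOn g (Icc 0 1)) {x y : ℝ}
    (hx : x ∈ Icc (0 : ℝ) 1) (hy : y ∈ Icc (0 : ℝ) 1) (hxy : x ≤ y)
    (h : envelope g x = envelope g y) : g x = g y := by
  rcases runMax_eq_or_exists hg hx.1 hxy hy.2 with h' | ⟨s, hs, h1, h2⟩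
  · rw [envelope, envelope, h'] at h
    linarith
  · have h3 := envelope_mono hg hm ⟨hx.1.trans hs.1.le, hs.2.trans hy.2⟩ hy hs.2
    linarith [envelope_le hg hx, hs.1]

end MonotoneCase

/-! ### Calibration -/

theorem eq_of_first_crossing {g : ℝ → ℝ} (hg : ContinuousOn g (Icc 0 1)) {x₁ p : ℝ} (h0 : 0 ≤ x₁)
    (h1 : x₁ < p) (hp : p ≤ 1) (hle : g x₁ ≤ x₁) (hgt : ∀ x ∈ Ioo x₁ p, x < g x) : g x₁ = x₁ := by
  refine le_antisymm hle ?_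
  have hc : ContinuousOn g (Icc x₁ p) := hg.mono (Icc_subset_Icc h0 hp)
  have : x₁ ∈ closure (Ioo x₁ p) := by
    rw [closure_Ioo h1.ne]
    exact ⟨le_rfl, h1.le⟩
  exact le_on_closure (f := fun x => x) (fun x hx => (hgt x hx).le) continuousOn_id
    (by rw [closure_Ioo h1.ne]; exact hc) this

/-- The envelope is the invariant of calibration. On `[x₁, p]` the function `g - id` is
nondecreasing from `0`, so the envelope of `g` is already the identity there; beyond `p`, the
function and its running maximum both drop by `g p - p`. -/
theorem CalibrationStep.preserves {g h : ℝ → ℝ} (hs : CalibrationStep g h)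
    (hg : ContinuousOn g (Icc 0 1)) (hg0 : g 0 = 0) :
    ContinuousOn h (Icc 0 1) ∧ h 0 = 0 ∧ EqOn (envelope h) (envelope g) (Icc 0 1) := by
  obtain ⟨x₁, x₂, p, h0, h1p, hp2, h21, hle, hgt, -, hd, -, rfl⟩ := hs
  set h : ℝ → ℝ := fun x => if x ≤ x₁ then g x else if x ≤ p then x else g x - g p + p with hh
  have hp1 := hp2.trans h21
  have hx1 : g x₁ = x₁ := eq_of_first_crossing hg h0 h1p hp1 (hle x₁ ⟨h0, le_rfl⟩)
    fun x hx => hgt x ⟨hx.1, hx.2.trans_le hp2⟩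
  have hA : ∀ x ≤ x₁, h x = g x := fun x hx => if_pos hx
  have hB : ∀ x, x₁ ≤ x → x ≤ p → h x = x := by
    intro x hx hxp
    rcases hx.eq_or_lt with rfl | hx
    · rw [hA _ le_rfl, hx1]
    · simp [hh, hx.not_ge, hxp]
  have hC : ∀ x, p ≤ x → h x = g x - g p + p := by
    intro x hx
    rcases hx.eq_or_lt with rfl | hx
    · rw [hB _ h1p.le le_rfl]
      ring
    · simp [hh, hx.not_ge, (h1p.trans hx).not_ge]
  have hhc : ContinuousOn h (Icc 0 1) := by
    have e : Icc (0 : ℝ) 1 = (Icc 0 x₁ ∪ Icc x₁ p) ∪ Icc p 1 := by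
      rw [Icc_union_Icc_eq_Icc h0 h1p.le, Icc_union_Icc_eq_Icc (h0.trans h1p.le) hp1]
    rw [e]
    refine ((ContinuousOn.union_of_isClosed ?_ ?_ isClosed_Icc isClosed_Icc).union_of_isClosed ?_
      (isClosed_Icc.union isClosed_Icc) isClosed_Icc)
    · exact (hg.mono (Icc_subset_Icc_right (h1p.le.trans hp1))).congr fun x hx => hA x hx.2
    · exact continuousOn_id.congr fun x hx => hB x hx.1 hx.2
    · exact (((hg.mono (Icc_subset_Icc_left (h0.trans h1p.le))).sub continuousOn_const).add
        continuousOn_const).congr fun x hx => hC x hx.1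
  refine ⟨hhc, (hA 0 h0).trans hg0, ?_⟩
  have hmono : MonotoneOn (fun x => g x - x) (Icc x₁ p) := by
    -- `deriv` is `0` at points of non-differentiability, so a slope of at least `1` forces
    -- differentiability.
    have hdiff : ∀ x ∈ Ioo x₁ p, DifferentiableAt ℝ g x := fun x hx =>
      differentiableAt_of_deriv_ne_zero (by linarith [hd x hx])
    refine monotoneOn_of_deriv_nonneg (convex_Icc _ _)
      ((hg.mono (Icc_subset_Icc h0 hp1)).sub continuousOn_id) ?_ ?_
    · rw [interior_Icc]
      exact fun x hx => ((hdiff x hx).sub differentiableAt_id).differentiableWithinAt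
    · rw [interior_Icc]
      intro x hx
      have := (((hdiff x hx).hasDerivAt).sub (hasDerivAt_id x)).deriv
      have h2 : deriv (fun x => g x - x) x = deriv g x - 1 := this
      rw [h2]
      linarith [hd x hx]
  have hgm0 : ∀ x ∈ Icc (0 : ℝ) 1, 0 ≤ runMax g x := fun x hx => by
    have := le_runMax hg le_rfl hx.1 hx.2
    rwa [hg0, sub_zero] at this
  have hhm0 : ∀ x ∈ Icc (0 : ℝ) 1, 0 ≤ runMax h x := fun x hx => by
    have := le_runMax hhc le_rfl hx.1 hx.2
    rwa [hA 0 h0, hg0, sub_zero] at this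
  have hgp : 0 ≤ g p - p := by
    have := hmono ⟨le_rfl, h1p.le⟩ ⟨h1p.le, le_rfl⟩ h1p.le
    simp only [hx1, sub_self] at this
    exact this
  intro x hx
  rcases le_total x x₁ with hxa | hxa
  · have : runMax h x = runMax g x := by
      rw [runMax, runMax]
      congr 1
      refine image_congr fun s hs => ?_
      rw [hA s (hs.2.trans hxa)]
    rw [envelope, envelope, this, hA x hxa]
  rcases le_total x p with hxp | hxp
  · have e1 : runMax g x = g x - x := by
      refine le_antisymm ?_ (le_runMax hg hx.1 le_rfl hx.2)
      obtain ⟨s, hs, e⟩ := exists_runMax_eq hg hx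
      rw [← e]
      rcases le_total s x₁ with h' | h'
      · have h2 := hmono ⟨le_rfl, h1p.le⟩ ⟨hxa, hxp⟩ hxa
        simp only [hx1, sub_self] at h2
        linarith [hle s ⟨hs.1, h'⟩]
      · exact hmono ⟨h', hs.2.trans hxp⟩ ⟨hxa, hxp⟩ hs.2
    have e2 : runMax h x = 0 := by
      refine le_antisymm ?_ (hhm0 x hx)
      obtain ⟨s, hs, e⟩ := exists_runMax_eq hhc hx
      rw [← e]
      rcases le_total s x₁ with h' | h'
      · rw [hA s h']
        linarith [hle s ⟨hs.1, h'⟩]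
      · rw [hB s h' (hs.2.trans hxp)]
        linarith
    rw [envelope, envelope, e1, e2, hB x hxa hxp]
    ring
  -- Points left of `p` do not matter: there `h s - s ≤ 0` and `g s - s ≤ g p - p`, and these bounds
  -- are attained at `0` and at `p`.
  · have e : runMax h x = runMax g x - (g p - p) := by
      refine le_antisymm ?_ ?_
      · obtain ⟨s, hs, e⟩ := exists_runMax_eq hhc hx
        rw [← e]
        have hpx := le_runMax hg (h0.trans h1p.le) hxp hx.2
        rcases le_total s x₁ with h' | h'
        · rw [hA s h']
          linarith [hle s ⟨hs.1, h'⟩]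
        rcases le_total s p with h'' | h''
        · rw [hB s h' h'']
          linarith
        · rw [hC s h'']
          linarith [le_runMax hg hs.1 hs.2 hx.2]
      · obtain ⟨s, hs, e⟩ := exists_runMax_eq hg hx
        rw [← e]
        have := hhm0 x hx
        rcases le_total s x₁ with h' | h'
        · linarith [hle s ⟨hs.1, h'⟩]
        rcases le_total s p with h'' | h''
        · have h2 := hmono ⟨h', h''⟩ ⟨h1p.le, le_rfl⟩ h''
          simp only at h2
          linarith
        · have h2 := le_runMax hhc hs.1 hs.2 hx.2
          rw [hC s h''] at h2
          linarith
    rw [envelope, envelope, e, hC x hxp]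
    ring

/-- The envelope survives every calibration, and the running maximum of an output is `0`, so the
output is its own envelope. -/
theorem IsCalibrationOutput.eqOn_envelope {g h : ℝ → ℝ} (hh : IsCalibrationOutput g h)
    (hg : ContinuousOn g (Icc 0 1)) (hg0 : g 0 = 0) : EqOn h (envelope g) (Icc 0 1) := by
  obtain ⟨hr, hle⟩ := hh
  have key : ContinuousOn h (Icc 0 1) ∧ h 0 = 0 ∧ EqOn (envelope h) (envelope g) (Icc 0 1) := by
    clear hle
    induction hr with
    | refl => exact ⟨hg, hg0, fun _ _ => rfl⟩
    | tail _ hs ih =>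
      obtain ⟨h1, h2, h3⟩ := hs.preserves ih.1 ih.2.1
      exact ⟨h1, h2, h3.trans ih.2.2⟩
  obtain ⟨hc, h0, he⟩ := key
  intro x hx
  rw [← he hx, envelope]
  have : runMax h x = 0 := by
    refine le_antisymm ?_ ?_
    · obtain ⟨s, hs, e⟩ := exists_runMax_eq hc hx
      rw [← e]
      linarith [hle s ⟨hs.1, hs.2.trans hx.2⟩]
    · have := le_runMax hc le_rfl hx.1 hx.2
      rwa [h0, sub_zero] at this
  rw [this, sub_zero]

/-- Repeated calibration of a function that has already been treated up to `a`. -/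
theorem exists_isCalibrationOutput_aux {β : ℝ → ℝ}
    (hd : ∀ x ∈ Ioo (0 : ℝ) 1, DifferentiableAt ℝ β x) :
    ∀ (n : ℕ) (a d : ℝ) (g : ℝ → ℝ), a ∈ Icc (0 : ℝ) 1 → ContinuousOn g (Icc 0 1) → g 0 = 0 →
      (∀ x ∈ Icc 0 a, g x ≤ x) → (∀ x ∈ Icc a 1, g x = β x + d) →
      {x ∈ Ioo a 1 | deriv β x = 1}.Finite → {x ∈ Ioo a 1 | deriv β x = 1}.ncard = n →
      ∃ h, IsCalibrationOutput g h := by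
  intro n
  -- The induction counts the critical points of β to the right of `a`. Beyond `a` the current
  -- function is a vertical shift of β, so calibrating never creates new ones, and the endpoint `p <
  -- 1` of a calibration leaves the count.
  induction n using Nat.strong_induction_on with
  | _ n ih =>
  intro a d g ha hg hg0 hga hgβ hfin hcard
  by_cases hall : ∀ x ∈ Icc (0 : ℝ) 1, g x ≤ x
  · exact ⟨g, Relation.ReflTransGen.refl, hall⟩
  push Not at hall
  obtain ⟨y₀, hy₀, hy₀g⟩ := hall
  -- the first crossing point
  set S : Set ℝ := {x ∈ Icc (0 : ℝ) 1 | x < g x} with hS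
  have hSne : S.Nonempty := ⟨y₀, hy₀, hy₀g⟩
  have hSb : BddBelow S := ⟨0, fun x hx => hx.1.1⟩
  set x₁ := sInf S with hx₁
  have hax₁ : a ≤ x₁ := le_csInf hSne fun x hx => by
    by_contra! h
    exact (hga x ⟨hx.1.1, h.le⟩).not_gt hx.2
  have hx₁y : x₁ ≤ y₀ := csInf_le hSb ⟨hy₀, hy₀g⟩
  have h0x₁ : 0 ≤ x₁ := ha.1.trans hax₁
  have hlt : ∀ x, 0 ≤ x → x < x₁ → g x ≤ x := by
    intro x hx hxx
    by_contra! h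
    exact (csInf_le hSb ⟨⟨hx, hxx.le.trans (hx₁y.trans hy₀.2)⟩, h⟩).not_gt hxx
  have hgx₁ : g x₁ ≤ x₁ := by
    rcases h0x₁.eq_or_lt with h | h
    · rw [← h, hg0]
    · have hc : ContinuousOn g (Icc 0 x₁) := hg.mono (Icc_subset_Icc_right (hx₁y.trans hy₀.2))
      have hm : x₁ ∈ closure (Ioo 0 x₁) := by
        rw [closure_Ioo h.ne]
        exact ⟨h.le, le_rfl⟩
      exact le_on_closure (g := fun x => x) (fun x hx => hlt x hx.1.le hx.2)
        (by rw [closure_Ioo h.ne]; exact hc) continuousOn_id hm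
  have hle : ∀ x ∈ Icc 0 x₁, g x ≤ x := by
    intro x hx
    rcases hx.2.eq_or_lt with rfl | h
    · exact hgx₁
    · exact hlt x hx.1 h
  have hx₁1 : x₁ < 1 := by
    refine (hx₁y.lt_of_ne ?_).trans_le hy₀.2
    rintro h
    rw [← h] at hy₀g
    exact hgx₁.not_gt hy₀g
  have hderiv : ∀ x ∈ Ioo x₁ 1, deriv g x = deriv β x := by
    intro x hx
    have : g =ᶠ[nhds x] fun z => β z + d := by
      filter_upwards [Ioo_mem_nhds hx.1 hx.2] with z hz
      exact hgβ z ⟨hax₁.trans hz.1.le, hz.2.le⟩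
    rw [this.deriv_eq, deriv_add_const]
  have hdg : ∀ x ∈ Ioo x₁ 1, DifferentiableAt ℝ g x := by
    intro x hx
    have : g =ᶠ[nhds x] fun z => β z + d := by
      filter_upwards [Ioo_mem_nhds hx.1 hx.2] with z hz
      exact hgβ z ⟨hax₁.trans hz.1.le, hz.2.le⟩
    exact ((hd x ⟨h0x₁.trans_lt hx.1, hx.2⟩).add_const d).congr_of_eventuallyEq this
  -- the next critical point
  obtain ⟨p, hp₁, hp1, hpne, hpor⟩ : ∃ p, x₁ < p ∧ p ≤ 1 ∧ (∀ x ∈ Ioo x₁ p, deriv β x ≠ 1) ∧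
      (p = 1 ∨ p < 1 ∧ deriv β p = 1) := by
    set T : Set ℝ := {x ∈ Ioo x₁ 1 | deriv β x = 1} with hT
    have hTfin : T.Finite := hfin.subset fun x hx => ⟨⟨hax₁.trans_lt hx.1.1, hx.1.2⟩, hx.2⟩
    rcases T.eq_empty_or_nonempty with hTe | hTe
    · refine ⟨1, hx₁1, le_rfl, fun x hx h => ?_, Or.inl rfl⟩
      exact (hTe ▸ (⟨hx, h⟩ : x ∈ T) : x ∈ (∅ : Set ℝ))
    · obtain ⟨p, hpT, hpmin⟩ := hTfin.exists_minimalFor id T hTe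
      refine ⟨p, hpT.1.1, hpT.1.2.le, fun x hx h => ?_, Or.inr ⟨hpT.1.2, hpT.2⟩⟩
      exact (hpmin (j := x) ⟨⟨hx.1, hx.2.trans hpT.1.2⟩, h⟩ hx.2.le).not_gt hx.2
  have hsub : Ioo x₁ p ⊆ Ioo x₁ 1 := Ioo_subset_Ioo_right hp1
  have hφc : ContinuousOn (fun x => g x - x) (Icc x₁ p) :=
    (hg.mono (Icc_subset_Icc h0x₁ hp1)).sub continuousOn_id
  have hφd : ∀ x ∈ Ioo x₁ p, deriv (fun x => g x - x) x = deriv β x - 1 := by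
    intro x hx
    have := (((hdg x (hsub hx)).hasDerivAt).sub (hasDerivAt_id x)).deriv
    rw [hderiv x (hsub hx)] at this
    exact this
  -- By Darboux, a derivative that avoids `1` stays on one side of it. Staying below would keep `g`
  -- under the diagonal on `[x₁, p]`, although `x₁` is the infimum of the points above it.
  have hgt1 : ∀ x ∈ Ioo x₁ p, 1 < deriv β x := by
    refine (hasDerivWithinAt_forall_lt_or_forall_gt_of_forall_ne (f := β) (convex_Ioo x₁ p)
      (fun x hx => ((hd x ⟨h0x₁.trans_lt hx.1, hx.2.trans_le hp1⟩).hasDerivAt).hasDerivWithinAt)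
      hpne).resolve_left fun hneg => ?_
    have hanti : StrictAntiOn (fun x => g x - x) (Icc x₁ p) := by
      refine strictAntiOn_of_deriv_neg (convex_Icc _ _) hφc fun x hx => ?_
      rw [interior_Icc] at hx
      rw [hφd x hx]
      linarith [hneg x hx]
    obtain ⟨z, hzS, hzp⟩ := exists_lt_of_csInf_lt hSne (show sInf S < p from hp₁)
    have hz1 : x₁ ≤ z := csInf_le hSb hzS
    have h1 := hanti.antitoneOn ⟨le_rfl, hp₁.le⟩ ⟨hz1, hzp.le⟩ hz1
    have h2 := hzS.2
    linarith
  have hmono : StrictMonoOn (fun x => g x - x) (Icc x₁ p) := by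
    refine strictMonoOn_of_deriv_pos (convex_Icc _ _) hφc fun x hx => ?_
    rw [interior_Icc] at hx
    rw [hφd x hx]
    linarith [hgt1 x hx]
  have hgex₁ : x₁ ≤ g x₁ := by
    by_contra! hneg
    have hcw : ContinuousWithinAt (fun x => g x - x) (Icc x₁ p) x₁ := hφc x₁ ⟨le_rfl, hp₁.le⟩
    have hev : ∀ᶠ x in nhdsWithin x₁ (Icc x₁ p), g x - x < 0 :=
      hcw.eventually_lt_const (by linarith)
    obtain ⟨ε, hε, hball⟩ := Metric.mem_nhdsWithin_iff.mp hev
    obtain ⟨z, hzS, hzp⟩ := exists_lt_of_csInf_lt hSne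
      (show sInf S < min p (x₁ + ε) from lt_min hp₁ (by linarith))
    have hz1 : x₁ ≤ z := csInf_le hSb hzS
    have h1 : z ∈ {x | g x - x < 0} := by
      refine hball ⟨?_, hz1, (hzp.trans_le (min_le_left _ _)).le⟩
      rw [Metric.mem_ball, Real.dist_eq, abs_of_nonneg (sub_nonneg.mpr hz1)]
      linarith [hzp.trans_le (min_le_right p (x₁ + ε))]
    have h2 : g z - z < 0 := h1
    linarith [hzS.2]
  have hpos : ∀ x, x₁ < x → x ≤ p → x < g x := by
    intro x hx hxp
    have := hmono ⟨le_rfl, hp₁.le⟩ ⟨hx.le, hxp⟩ hx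
    simp only at this
    linarith
  -- the end of the first interval above the diagonal
  obtain ⟨x₂, hpx₂, hx₂1, hx₂gt, hx₂or⟩ : ∃ x₂, p ≤ x₂ ∧ x₂ ≤ 1 ∧ (∀ x, p ≤ x → x < x₂ → x < g x) ∧
      (x₂ = 1 ∨ g x₂ ≤ x₂) := by
    set T : Set ℝ := {x ∈ Icc p 1 | g x ≤ x} with hT
    have hTc : IsCompact T := by
      refine isCompact_Icc.of_isClosed_subset ?_ (sep_subset _ _)
      exact isClosed_Icc.isClosed_le (hg.mono (Icc_subset_Icc_left (h0x₁.trans hp₁.le)))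
        continuousOn_id
    rcases T.eq_empty_or_nonempty with hTe | hTe
    · refine ⟨1, hp1, le_rfl, fun x hx hx' => ?_, Or.inl rfl⟩
      by_contra! h
      exact (hTe ▸ (⟨⟨hx, hx'.le⟩, h⟩ : x ∈ T) : x ∈ (∅ : Set ℝ))
    · obtain ⟨z, hzT, hz⟩ := hTc.exists_isLeast hTe
      refine ⟨z, hzT.1.1, hzT.1.2, fun x hx hx' => ?_, Or.inr hzT.2⟩
      by_contra! h
      exact (hz ⟨⟨hx, hx'.le.trans hzT.1.2⟩, h⟩).not_gt hx'
  set h : ℝ → ℝ := fun x => if x ≤ x₁ then g x else if x ≤ p then x else g x - g p + p with hh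
  have hstep : CalibrationStep g h := by
    refine ⟨x₁, x₂, p, h0x₁, hp₁, hpx₂, hx₂1, hle, fun x hx => ?_, hx₂or,
      fun x hx => ?_, ?_, rfl⟩
    · rcases le_total x p with hxp | hxp
      · exact hpos x hx.1 hxp
      · exact hx₂gt x hxp hx.2
    · rw [hderiv x (hsub hx)]
      exact (hgt1 x hx).le
    · rcases hpor with h1 | h1
      · exact Or.inl h1
      · right
        rw [hderiv p ⟨hp₁, h1.1⟩, h1.2]
  have hpr := hstep.preserves hg hg0
  have hhp : ∀ x ∈ Icc 0 p, h x ≤ x := by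
    intro x hx
    by_cases hx1 : x ≤ x₁
    · simp only [hh, if_pos hx1]
      exact hle x ⟨hx.1, hx1⟩
    · simp [hh, hx1, hx.2]
  have hhβ : ∀ x ∈ Icc p 1, h x = β x + (d - g p + p) := by
    intro x hx
    have hgx := hgβ x ⟨hax₁.trans (hp₁.le.trans hx.1), hx.2⟩
    rcases hx.1.eq_or_lt with rfl | hx'
    · simp only [hh, if_neg hp₁.not_ge, if_pos le_rfl]
      linarith
    · simp only [hh, if_neg (hp₁.trans hx').not_ge, if_neg hx'.not_ge]
      linarith
  have hap : a < p := hax₁.trans_lt hp₁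
  have hsub' : {x ∈ Ioo p 1 | deriv β x = 1} ⊆ {x ∈ Ioo a 1 | deriv β x = 1} :=
    fun x hx => ⟨⟨hap.trans hx.1.1, hx.1.2⟩, hx.2⟩
  rcases hpor with hpe | hpc
  · refine ⟨h, Relation.ReflTransGen.single hstep, ?_⟩
    rw [hpe] at hhp
    exact hhp
  · have hlt : {x ∈ Ioo p 1 | deriv β x = 1}.ncard < n := by
      rw [← hcard]
      refine ncard_lt_ncard ⟨hsub', fun hcon => ?_⟩ hfin
      exact (hcon ⟨⟨hap, hpc.1⟩, hpc.2⟩ : p ∈ {x ∈ Ioo p 1 | deriv β x = 1}).1.1.ne rfl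
    obtain ⟨h', hr, hh'⟩ := ih _ hlt p _ h ⟨h0x₁.trans hp₁.le, hp1⟩ hpr.1 hpr.2.1 hhp hhβ
      (hfin.subset hsub') rfl
    exact ⟨h', hr.head hstep, hh'⟩

theorem exists_isCalibrationOutput {β : ℝ → ℝ} (hβ : ContinuousOn β (Icc 0 1)) (hβ0 : β 0 = 0)
    (hd : ∀ x ∈ Ioo (0 : ℝ) 1, DifferentiableAt ℝ β x)
    (hfin : {x ∈ Ioo (0 : ℝ) 1 | deriv β x = 1}.Finite) : ∃ h, IsCalibrationOutput β h :=
  exists_isCalibrationOutput_aux hd _ 0 0 β ⟨le_rfl, zero_le_one⟩ hβ hβ0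
    (fun x hx => by rw [le_antisymm hx.2 hx.1, hβ0]) (fun x _ => (add_zero _).symm) hfin rfl

/-! ### Expected rewards -/

theorem topKReward_le {N K : ℕ} {R : ℝ} (hR : 0 ≤ R) (x : Fin N → ℝ) (i : Fin N) :
    topKReward K R x i ≤ R / K := by
  unfold topKReward
  split_ifs
  · positivity
  · exact mul_le_of_le_one_right (by positivity) (min_le_left _ _)

/-- The integral of a non-integrable function is `0`, hence `0 ≤ a`. This bounds the reward of an
arbitrary deviation without a measurability check. -/
theorem integral_le_of_forall_le {Ω : Type*} [MeasurableSpace Ω] {P : Measure Ω}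
    [IsProbabilityMeasure P] {X : Ω → ℝ} {a : ℝ} (ha : 0 ≤ a) (h : ∀ ω, X ω ≤ a) :
    ∫ ω, X ω ∂P ≤ a := by
  by_cases hX : Integrable X P
  · refine (integral_mono hX (integrable_const a) h).trans ?_
    simp
  · rwa [integral_undef hX]

/-- Without ties, the reward is decided by the number of users strictly above. -/
theorem topKReward_of_forall_ne {N K : ℕ} {R : ℝ} {x : Fin N → ℝ} {i : Fin N} (hi : x i ≠ 0)
    (hne : ∀ j, j ≠ i → x j ≠ x i) :
    topKReward K R x i = if numAbove x i < K then R / K else 0 := by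
  have ht : numTied x i = 1 := by
    rw [numTied, Finset.card_eq_one]
    refine ⟨i, ?_⟩
    ext j
    simp only [Finset.mem_filter, Finset.mem_univ, true_and, Finset.mem_singleton]
    exact ⟨fun h => by_contra fun hj => hne j hj h, fun h => h ▸ rfl⟩
  rw [topKReward, if_neg hi, ht, Nat.cast_one, div_one]
  split_ifs with h
  · have : (numAbove x i : ℝ) + 1 ≤ K := by exact_mod_cast h
    rw [max_eq_right (by linarith), min_eq_left (by linarith), mul_one]
  · have : (K : ℝ) ≤ numAbove x i := by exact_mod_cast not_lt.mp h
    rw [max_eq_left (by linarith), min_eq_right zero_le_one, mul_zero]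

/-- The probability that fewer than `K` opponents have a type above `s`. -/
theorem measureReal_card_lt {N : ℕ} (K : ℕ) (hKN : K < N) (μ : Measure ℝ) [IsProbabilityMeasure μ]
    (i : Fin N) (s : ℝ) :
    (Measure.pi fun _ : Fin N => μ).real
        {θ | ((Finset.univ.erase i).filter fun j => s < θ j).card < K}
      = winProb (N - 1) K (ProbabilityTheory.cdf μ s) := by
  classical
  set u := ProbabilityTheory.cdf μ s with hu
  have hIic : μ.real (Iic s) = u := (ProbabilityTheory.cdf_eq_real μ s).symm
  have hIoi : μ.real (Ioi s) = 1 - u := by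
    rw [← compl_Iic, probReal_compl_eq_one_sub measurableSet_Iic, hIic]
  set T : Finset (Fin N) := Finset.univ.erase i with hT
  have hTc : T.card = N - 1 := by
    rw [hT, Finset.card_erase_of_mem (Finset.mem_univ i), Finset.card_univ, Fintype.card_fin]
  -- The event is split by the exact set `S` of opponents above `s`. Each piece is a box, free in
  -- coordinate `i`, whose measure depends only on the size of `S`; grouping by size gives the
  -- binomial sum.
  set box : Finset (Fin N) → Set (Fin N → ℝ) := fun S =>
    Set.univ.pi fun j => if j = i then Set.univ else if j ∈ S then Ioi s else Iic s with hbox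
  have hmem : ∀ S ∈ T.powerset, ∀ θ, θ ∈ box S ↔ T.filter (fun j => s < θ j) = S := by
    intro S hS θ
    rw [Finset.mem_powerset] at hS
    simp only [hbox, Set.mem_univ_pi, Finset.ext_iff, Finset.mem_filter]
    refine forall_congr' fun j => ?_
    by_cases hj : j = i
    · have h1 : j ∉ T := by simp [hT, hj]
      have h2 : j ∉ S := fun h => h1 (hS h)
      simp [hj] at h1 h2 ⊢
      simp [h1, h2]
    · have h1 : j ∈ T := by simp [hT, hj]
      by_cases hjS : j ∈ S <;> simp [hj, hjS, h1]
  have hset : {θ : Fin N → ℝ | (T.filter fun j => s < θ j).card < K}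
      = ⋃ S ∈ T.powerset.filter (fun S => S.card < K), box S := by
    ext θ
    simp only [mem_ofPred_eq, mem_iUnion, Finset.mem_filter, exists_prop]
    constructor
    · intro h
      have hp : T.filter (fun j => s < θ j) ∈ T.powerset :=
        Finset.mem_powerset.mpr (Finset.filter_subset _ _)
      exact ⟨_, ⟨hp, h⟩, (hmem _ hp θ).mpr rfl⟩
    · rintro ⟨S, ⟨hS, hc⟩, hθ⟩
      rwa [(hmem S hS θ).mp hθ]
  have hbm : ∀ S, MeasurableSet (box S) := fun S =>
    MeasurableSet.univ_pi fun j => by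
      split_ifs
      exacts [MeasurableSet.univ, measurableSet_Ioi, measurableSet_Iic]
  have hbv : ∀ S ∈ T.powerset, (Measure.pi fun _ : Fin N => μ).real (box S)
      = (1 - u) ^ S.card * u ^ (N - 1 - S.card) := by
    intro S hS
    have hST := Finset.mem_powerset.mp hS
    rw [measureReal_def, hbox, Measure.pi_pi, ENNReal.toReal_prod,
      ← Finset.mul_prod_erase _ _ (Finset.mem_univ i), ← hT]
    simp only [if_true, measure_univ, ENNReal.toReal_one, one_mul]
    rw [← Finset.prod_sdiff hST, mul_comm]
    congr 1
    · rw [← hIoi, ← Finset.prod_const]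
      refine Finset.prod_congr rfl fun j hj => ?_
      have : j ≠ i := Finset.ne_of_mem_erase (hST hj)
      simp [this, hj, measureReal_def]
    · rw [← hIic, ← hTc, ← Finset.card_sdiff_of_subset hST, ← Finset.prod_const]
      refine Finset.prod_congr rfl fun j hj => ?_
      rw [Finset.mem_sdiff] at hj
      have : j ≠ i := Finset.ne_of_mem_erase hj.1
      simp [this, hj.2, measureReal_def]
  rw [hset, measureReal_biUnion_finset _ fun S _ => hbm S]
  · rw [Finset.sum_congr rfl fun S hS => hbv S (Finset.mem_filter.mp hS).1, Finset.sum_filter,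
      Finset.sum_powerset_apply_card
        (fun k => if k < K then (1 - u) ^ k * u ^ (N - 1 - k) else 0), hTc, winProb]
    symm
    refine Finset.sum_subset_zero_on_sdiff (fun k hk => ?_) (fun k hk => ?_) fun k hk => ?_
    · rw [Finset.mem_range] at hk ⊢
      omega
    · rw [Finset.mem_sdiff, Finset.mem_range, Finset.mem_range] at hk
      simp [hk.2]
    · rw [if_pos (Finset.mem_range.mp hk), nsmul_eq_mul]
  · intro S hS S' hS' hne
    refine Set.disjoint_left.mpr fun θ h1 h2 => hne ?_
    rw [← (hmem S (Finset.mem_filter.mp hS).1 θ).mp h1,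
      ← (hmem S' (Finset.mem_filter.mp hS').1 θ).mp h2]

/-- If the common strategy `b` is nondecreasing and has null level sets, contributing `b s` yields
the prize exactly when fewer than `K` opponents have types above `s`. -/
theorem integral_topKReward {N : ℕ} (K : ℕ) (hKN : K < N) (R : ℝ) {μ : Measure ℝ}
    [IsProbabilityMeasure μ] (hμ : ∀ᵐ t ∂μ, t ∈ Icc (0 : ℝ) 1) {b : ℝ → ℝ}
    (hb : MonotoneOn b (Icc 0 1)) (i : Fin N) {s : ℝ} (hs : s ∈ Icc (0 : ℝ) 1) (hbs : b s ≠ 0)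
    (hnull : ∀ᵐ t ∂μ, b t ≠ b s) :
    ∫ θ : Fin N → ℝ, topKReward K R (Function.update (fun j => b (θ j)) i (b s)) i
        ∂(Measure.pi fun _ => μ)
      = R / K * winProb (N - 1) K (ProbabilityTheory.cdf μ s) := by
  have hall : ∀ᵐ θ ∂(Measure.pi fun _ : Fin N => μ), ∀ j, θ j ∈ Icc (0 : ℝ) 1 ∧ b (θ j) ≠ b s := by
    rw [ae_all_iff]
    intro j
    exact (measurePreserving_eval (fun _ : Fin N => μ) j).quasiMeasurePreserving.ae
      (hμ.and hnull)
  set A : Set (Fin N → ℝ) := {θ | ((Finset.univ.erase i).filter fun j => s < θ j).card < K} with hA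
  have hAm : MeasurableSet A := by
    have : Measurable fun θ : Fin N → ℝ =>
        ((Finset.univ.erase i).filter fun j => s < θ j).card := by
      simp only [Finset.card_filter]
      refine Finset.measurable_sum _ fun j _ => ?_
      exact Measurable.ite (measurableSet_lt measurable_const (measurable_pi_apply j))
        measurable_const measurable_const
    exact this measurableSet_Iio
  have hcong : (fun θ : Fin N → ℝ => topKReward K R (Function.update (fun j => b (θ j)) i (b s)) i)
      =ᵐ[Measure.pi fun _ => μ] A.indicator fun _ => R / K := by
    filter_upwards [hall] with θ hθ
    rw [topKReward_of_forall_ne (by simpa using hbs) (fun j hj => by simpa [hj] using (hθ j).2)]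
    have hn : numAbove (Function.update (fun j => b (θ j)) i (b s)) i
        = ((Finset.univ.erase i).filter fun j => s < θ j).card := by
      rw [numAbove]
      congr 1
      ext j
      simp only [Finset.mem_filter, Finset.mem_univ, true_and, Function.update_self,
        Finset.mem_erase, and_true]
      by_cases hj : j = i
      · simp [hj]
      · simp only [Function.update_of_ne hj, hj, ne_eq, not_false_eq_true, true_and]
        constructor
        · intro h
          by_contra! hle
          exact (hb (hθ j).1 hs hle).not_gt h
        · exact fun h => (hb hs (hθ j).1 h.le).lt_of_ne (hθ j).2.symm
    rw [hn]
    by_cases h : θ ∈ A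
    · rw [indicator_of_mem h]
      exact if_pos h
    · rw [indicator_of_notMem h]
      exact if_neg h
  rw [integral_congr_ae hcong, integral_indicator hAm, setIntegral_const, smul_eq_mul, mul_comm,
    hA, measureReal_card_lt K hKN μ i s]

/-- Equilibrium only depends on the values of the strategy on the type space. -/
theorem IsSymmetricPNE.congr {N K : ℕ} {R c : ℝ} {μ : Measure ℝ} [IsProbabilityMeasure μ]
    (hμ : ∀ᵐ t ∂μ, t ∈ Icc (0 : ℝ) 1) {b h : ℝ → ℝ} (hb : IsSymmetricPNE N K R c μ b)
    (hbh : EqOn h b (Icc 0 1)) : IsSymmetricPNE N K R c μ h := by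
  have hall : ∀ᵐ θ ∂(Measure.pi fun _ : Fin N => μ), ∀ j, θ j ∈ Icc (0 : ℝ) 1 := by
    rw [ae_all_iff]
    intro j
    exact (measurePreserving_eval (fun _ : Fin N => μ) j).quasiMeasurePreserving.ae hμ
  have hU : ∀ (i : Fin N) (q x : ℝ), expectedUtility K R c μ (fun _ => h) i q x
      = expectedUtility K R c μ (fun _ => b) i q x := by
    intro i q x
    unfold expectedUtility
    congr 1
    refine integral_congr_ae ?_
    filter_upwards [hall] with θ hθ
    have : (fun j => h (θ j)) = fun j => b (θ j) := funext fun j => hbh (hθ j)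
    rw [this]
  refine ⟨fun i => ⟨?_, fun q hq => ?_⟩, fun i q hq x hx => ?_⟩
  · have : (fun q : Icc (0 : ℝ) 1 => h q) = fun q : Icc (0 : ℝ) 1 => b q :=
      funext fun q => hbh q.2
    rw [this]
    exact (hb.1 i).1
  · change h q ∈ Icc 0 q
    rw [hbh hq]
    exact (hb.1 i).2 q hq
  · rw [hU, hU]
    simp only [hbh hq]
    exact hb.2 i q hq x hx

/-- A nondecreasing strategy whose level sets carry no mass of types is played without ties. -/
theorem ae_ne_of_cdf_eq {μ : Measure ℝ} [IsProbabilityMeasure μ] [NullSingletonClass μ]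
    (hμ : ∀ᵐ t ∂μ, t ∈ Icc (0 : ℝ) 1) {b : ℝ → ℝ} (hc : ContinuousOn b (Icc 0 1))
    (hb : ∀ x ∈ Icc (0 : ℝ) 1, ∀ y ∈ Icc (0 : ℝ) 1, x ≤ y → b x = b y →
      ProbabilityTheory.cdf μ x = ProbabilityTheory.cdf μ y) (v : ℝ) :
    ∀ᵐ t ∂μ, b t ≠ v := by
  -- The level set is compact, so it lies between its least and greatest elements, where `b` takes
  -- the same value; the interval they span is then null.
  set L : Set ℝ := Icc 0 1 ∩ b ⁻¹' {v} with hL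
  have hLc : IsCompact L :=
    isCompact_Icc.of_isClosed_subset (hc.preimage_isClosed_of_isClosed isClosed_Icc
      isClosed_singleton) inter_subset_left
  have hL0 : μ L = 0 := by
    rcases L.eq_empty_or_nonempty with h | h
    · rw [h, measure_empty]
    · obtain ⟨x, hx, hxm⟩ := hLc.exists_isLeast h
      obtain ⟨y, hy, hym⟩ := hLc.exists_isGreatest h
      have hxy : x ≤ y := hxm hy
      have h1 : μ.real (Ioc x y) = 0 := by
        rw [measureReal_Ioc_eq_cdf_sub hxy, hb x hx.1 y hy.1 hxy (hx.2.trans hy.2.symm), sub_self]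
      rw [measureReal_eq_zero_iff] at h1
      have hsub : L ⊆ Icc x y := fun z hz => ⟨hxm hz, hym hz⟩
      refine measure_mono_null hsub ?_
      rw [← Ioc_ae_eq_Icc.measure_eq, h1]
  filter_upwards [hμ, measure_eq_zero_iff_ae_notMem.mp hL0] with t ht h1 h2
  exact h1 ⟨ht, h2⟩

/-! ### The equilibrium -/

theorem monotoneOn_odeStrategy {N K : ℕ} {R c : ℝ} (hR : 0 < R) (hc : 0 < c) (hKN : K < N)
    {μ : Measure ℝ} [IsProbabilityMeasure μ] (hμ : HasContinuousDensityOnUnit μ) :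
    MonotoneOn (odeStrategy N K R c μ) (Icc 0 1) := by
  obtain ⟨-, hβc, f, hf0, hf⟩ := exists_hasDerivAt_cdf_odeStrategy N K R c hμ
  have hN : (1 : ℝ) ≤ N := by exact_mod_cast (by omega : 1 ≤ N)
  refine monotoneOn_of_deriv_nonneg (convex_Icc 0 1) hβc ?_ ?_ <;> rw [interior_Icc]
  · exact fun x hx => (hf x hx).2.differentiableAt.differentiableWithinAt
  · intro x hx
    rw [(hf x hx).2.deriv]
    have h1 := ProbabilityTheory.cdf_nonneg μ x
    have h2 := sub_nonneg.mpr (ProbabilityTheory.cdf_le_one μ x)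
    have h3 := hf0 x
    have h4 := hx.1.le
    have h5 := sub_nonneg.mpr hN
    positivity

/-- The first-order condition: `β' = (R / (c K)) x w'`, where `w` is the winning probability as a
function of the type. -/
theorem exists_hasDerivAt_winProb_cdf {N K : ℕ} (hK : 1 ≤ K) (hKN : K < N) (R c : ℝ)
    {μ : Measure ℝ} [IsProbabilityMeasure μ] (hμ : HasContinuousDensityOnUnit μ) :
    ContinuousOn (fun x => winProb (N - 1) K (ProbabilityTheory.cdf μ x)) (Icc 0 1) ∧
    ∃ w' : ℝ → ℝ, ∀ x ∈ Ioo (0 : ℝ) 1, 0 ≤ w' x ∧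
      HasDerivAt (fun x => winProb (N - 1) K (ProbabilityTheory.cdf μ x)) (w' x) x ∧
      HasDerivAt (odeStrategy N K R c μ) (R / (c * K) * (x * w' x)) x := by
  obtain ⟨hFc, -, f, hf0, hf⟩ := exists_hasDerivAt_cdf_odeStrategy N K R c hμ
  have hWc : Continuous (winProb (N - 1) K) :=
    continuous_iff_continuousAt.mpr fun u => (hasDerivAt_winProb _ K hK u).continuousAt
  refine ⟨hWc.comp_continuousOn hFc, _, fun x hx =>
    ⟨?_, (hasDerivAt_winProb _ K hK _).comp x (hf x hx).1, (hf x hx).2.congr_deriv ?_⟩⟩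
  · have h1 := ProbabilityTheory.cdf_nonneg μ x
    have h2 := sub_nonneg.mpr (ProbabilityTheory.cdf_le_one μ x)
    have h3 := hf0 x
    positivity
  · rw [Nat.cast_sub (by omega : 1 ≤ N), Nat.sub_right_comm N 1 K, Nat.sub_sub N 1 1]
    push_cast
    ring

/-- For a type `q`, the payoff of imitating type `x` under `β` increases up to `x = q` and decreases
afterwards. -/
theorem winProb_sub_odeStrategy {N K : ℕ} (hK : 1 ≤ K) (hKN : K < N) {R c : ℝ} (hR : 0 < R)
    (hc : 0 < c) {μ : Measure ℝ} [IsProbabilityMeasure μ] (hμ : HasContinuousDensityOnUnit μ)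
    {q : ℝ} (hq : q ∈ Icc (0 : ℝ) 1) {s : ℝ} (hs : s ∈ Icc (0 : ℝ) 1) :
    R / (c * K) * (q * winProb (N - 1) K (ProbabilityTheory.cdf μ s)) - odeStrategy N K R c μ s ≤
    R / (c * K) * (q * winProb (N - 1) K (ProbabilityTheory.cdf μ q)) - odeStrategy N K R c μ q := by
  obtain ⟨hwc, w', hw⟩ := exists_hasDerivAt_winProb_cdf hK hKN R c hμ
  have hβc := (exists_hasDerivAt_cdf_odeStrategy N K R c hμ).2.1
  set φ : ℝ → ℝ := fun x => R / (c * K) * (q * winProb (N - 1) K (ProbabilityTheory.cdf μ x))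
    - odeStrategy N K R c μ x with hφ
  have hφc : ContinuousOn φ (Icc 0 1) :=
    (continuousOn_const.mul (continuousOn_const.mul hwc)).sub hβc
  -- The factor `q - x` carries the sign change at `x = q`.
  have hφd : ∀ x ∈ Ioo (0 : ℝ) 1, HasDerivAt φ (R / (c * K) * ((q - x) * w' x)) x := fun x hx =>
    ((((hw x hx).2.1.const_mul q).const_mul (R / (c * K))).sub (hw x hx).2.2).congr_deriv (by ring)
  have hA : 0 ≤ R / (c * K) := by positivity
  rcases le_total s q with h | h
  · refine monotoneOn_of_deriv_nonneg (convex_Icc 0 q) (hφc.mono (Icc_subset_Icc_right hq.2)) ?_ ?_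
      ⟨hs.1, h⟩ ⟨hq.1, le_rfl⟩ h <;> rw [interior_Icc]
    · exact fun x hx =>
        (hφd x ⟨hx.1, hx.2.trans_le hq.2⟩).differentiableAt.differentiableWithinAt
    · intro x hx
      have hx' : x ∈ Ioo (0 : ℝ) 1 := ⟨hx.1, hx.2.trans_le hq.2⟩
      rw [(hφd x hx').deriv]
      exact mul_nonneg hA (mul_nonneg (by linarith [hx.2]) (hw x hx').1)
  · refine antitoneOn_of_deriv_nonpos (convex_Icc q 1) (hφc.mono (Icc_subset_Icc_left hq.1)) ?_ ?_
      ⟨le_rfl, hq.2⟩ ⟨h, hs.2⟩ h <;> rw [interior_Icc]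
    · exact fun x hx =>
        (hφd x ⟨hq.1.trans_lt hx.1, hx.2⟩).differentiableAt.differentiableWithinAt
    · intro x hx
      have hx' : x ∈ Ioo (0 : ℝ) 1 := ⟨hq.1.trans_lt hx.1, hx.2⟩
      rw [(hφd x hx').deriv]
      exact mul_nonpos_of_nonneg_of_nonpos hA
        (mul_nonpos_of_nonpos_of_nonneg (by linarith [hx.1]) (hw x hx').1)

/-- `β` is constant only on intervals without types. -/
theorem cdf_eq_of_odeStrategy_eq {N K : ℕ} (hK : 1 ≤ K) (hKN : K < N) {R c : ℝ} (hR : 0 < R)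
    (hc : 0 < c) {μ : Measure ℝ} [IsProbabilityMeasure μ] (hμ : HasContinuousDensityOnUnit μ)
    {x y : ℝ} (hx : x ∈ Icc (0 : ℝ) 1) (hy : y ∈ Icc (0 : ℝ) 1) (hxy : x ≤ y)
    (h : odeStrategy N K R c μ x = odeStrategy N K R c μ y) :
    ProbabilityTheory.cdf μ x = ProbabilityTheory.cdf μ y := by
  obtain ⟨hwc, w', hw⟩ := exists_hasDerivAt_winProb_cdf hK hKN R c hμ
  have hm := monotoneOn_odeStrategy (K := K) hR hc hKN hμ
  have hA : R / (c * K) ≠ 0 := by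
    have : (0 : ℝ) < K := by exact_mod_cast hK
    positivity
  -- Monotone with equal end values, β is constant on `[x, y]`; hence `w' = 0` inside, the winning
  -- probability is constant, and its strict monotonicity in the distribution function gives the
  -- claim.
  have hconst : ∀ z ∈ Icc x y, odeStrategy N K R c μ z = odeStrategy N K R c μ x := fun z hz =>
    le_antisymm (h ▸ hm ⟨hx.1.trans hz.1, hz.2.trans hy.2⟩ hy hz.2)
      (hm hx ⟨hx.1.trans hz.1, hz.2.trans hy.2⟩ hz.1)
  have hw0 : ∀ z ∈ Ioo x y, w' z = 0 := by
    intro z hz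
    have hz' : z ∈ Ioo (0 : ℝ) 1 := ⟨hx.1.trans_lt hz.1, hz.2.trans_le hy.2⟩
    have h1 : HasDerivAt (odeStrategy N K R c μ) 0 z :=
      (hasDerivAt_const z (odeStrategy N K R c μ x)).congr_of_eventuallyEq
        (Filter.eventually_of_mem (Ioo_mem_nhds hz.1 hz.2) fun t ht =>
          hconst t (Ioo_subset_Icc_self ht))
    have h2 := (hw z hz').2.2.unique h1
    simpa [hA, hz'.1.ne'] using h2
  have hwxy : winProb (N - 1) K (ProbabilityTheory.cdf μ y)
      = winProb (N - 1) K (ProbabilityTheory.cdf μ x) := by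
    rcases hxy.eq_or_lt with rfl | hlt
    · rfl
    obtain ⟨z, hz, hz'⟩ := exists_hasDerivAt_eq_slope
      (fun x => winProb (N - 1) K (ProbabilityTheory.cdf μ x)) w' hlt
      (hwc.mono (Icc_subset_Icc hx.1 hy.2))
      fun z hz => (hw z ⟨hx.1.trans_lt hz.1, hz.2.trans_le hy.2⟩).2.1
    rw [hw0 z hz, eq_comm, div_eq_zero_iff] at hz'
    rcases hz' with h' | h' <;> linarith
  exact ((strictMonoOn_winProb hK (by omega)).injOn
    ⟨ProbabilityTheory.cdf_nonneg μ y, ProbabilityTheory.cdf_le_one μ y⟩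
    ⟨ProbabilityTheory.cdf_nonneg μ x, ProbabilityTheory.cdf_le_one μ x⟩ hwxy).symm

/-- The envelope of the first-order strategy is an equilibrium. -/
theorem isSymmetricPNE_envelope {N K : ℕ} (hK : 1 ≤ K) (hKN : K < N) {R c : ℝ} (hR : 0 < R)
    (hc : 0 < c) {μ : Measure ℝ} [IsProbabilityMeasure μ] (hμ : HasContinuousDensityOnUnit μ) :
    IsSymmetricPNE N K R c μ (envelope (odeStrategy N K R c μ)) := by
  have hNA := hμ.noAtoms
  have hβc := (exists_hasDerivAt_cdf_odeStrategy N K R c hμ).2.1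
  have hβm := monotoneOn_odeStrategy (K := K) hR hc hKN hμ
  set β := odeStrategy N K R c μ with hβ
  set b := envelope β with hb
  set w : ℝ → ℝ := fun x => winProb (N - 1) K (ProbabilityTheory.cdf μ x) with hw
  have hbm : MonotoneOn b (Icc 0 1) := envelope_mono hβc hβm
  have hbc : ContinuousOn b (Icc 0 1) := continuousOn_envelope hβc hβm
  have hb0 : b 0 = 0 := envelope_zero β
  have hF : ∀ x ∈ Icc (0 : ℝ) 1, ∀ y ∈ Icc (0 : ℝ) 1, x ≤ y → b x = b y →
      ProbabilityTheory.cdf μ x = ProbabilityTheory.cdf μ y := fun x hx y hy hxy h =>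
    cdf_eq_of_odeStrategy_eq hK hKN hR hc hμ hx hy hxy (eq_of_envelope_eq hβc hβm hx hy hxy h)
  have hU : ∀ (i : Fin N) (q s : ℝ), s ∈ Icc (0 : ℝ) 1 →
      expectedUtility K R c μ (fun _ => b) i q (b s) = R / K * w s - c * b s / q := by
    intro i q s hs
    unfold expectedUtility
    congr 1
    by_cases hbs : b s = 0
    -- A zero contribution earns nothing by rule. The formula agrees: almost surely no type lies
    -- below `s`, so `w s = 0`, since there are at least `K` opponents.
    · have h1 := hF 0 ⟨le_rfl, zero_le_one⟩ s hs hs.1 (hb0.trans hbs.symm)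
      have h2 : w s = 0 := by
        simp only [hw]
        rw [← h1, cdf_zero hμ, winProb_zero (by omega)]
      rw [h2, hbs]
      simp [topKReward]
    · exact integral_topKReward K hKN R hμ.ae_mem hbm i hs hbs (ae_ne_of_cdf_eq hμ.ae_mem hbc hF _)
  have hKR : (0 : ℝ) < K := by exact_mod_cast hK
  have hopt : ∀ q ∈ Icc (0 : ℝ) 1, 0 < q → ∀ s ∈ Icc (0 : ℝ) 1, b s ≤ q →
      R / K * w s - c * b s / q ≤ R / K * w q - c * b q / q := by
    intro q hq hq0 s hs hsq
    have h1 := winProb_sub_odeStrategy hK hKN hR hc hμ hq hs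
    -- This is where feasibility of the deviation enters: an increase of the running maximum after
    -- `q` would put `b s` above `q`.
    have h2 : runMax β q ≥ runMax β s := by
      rcases le_total s q with h | h
      · exact runMax_mono hβc hs.1 h hq.2
      · rcases runMax_eq_or_exists hβc hq.1 h hs.2 with h' | ⟨t, ht, h3, -⟩
        · exact h'.le
        · have h4 : b t ≤ b s := hbm ⟨hq.1.trans ht.1.le, ht.2.trans hs.2⟩ hs ht.2
          have h5 : b t = t := h3
          linarith [ht.1]
    have h3 : R / (c * K) * (q * w s) - b s ≤ R / (c * K) * (q * w q) - b q := by
      simp only [hb, envelope]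
      linarith
    have e : ∀ t, R / K * w t - c * b t / q = (R / (c * K) * (q * w t) - b t) * (c / q) := by
      intro t
      field_simp
    rw [e, e]
    exact mul_le_mul_of_nonneg_right h3 (by positivity)
  refine ⟨fun i => ⟨(continuousOn_iff_continuous_domRestrict.mp hbc).measurable, fun q hq =>
    ⟨envelope_nonneg hβc hβm hq, envelope_le hβc hq⟩⟩, fun i q hq x hx => ?_⟩
  rcases hq.1.eq_or_lt with rfl | hq0
  · change _ ≤ expectedUtility K R c μ (fun _ => b) i 0 (b 0)
    rw [hb0, le_antisymm hx.2 hx.1]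
  have h11 : (1 : ℝ) ∈ Icc (0 : ℝ) 1 := ⟨zero_le_one, le_rfl⟩
  rcases le_or_gt x (b 1) with hxb | hxb
  -- By continuity every contribution up to `b 1` imitates some type. A larger one costs more than
  -- `b 1`, which already wins with probability one.
  · obtain ⟨s, hs, rfl⟩ := intermediate_value_Icc zero_le_one hbc ⟨hb0.le.trans hx.1, hxb⟩
    rw [hU i q s hs, hU i q q hq]
    exact hopt q hq hq0 s hs hx.2
  · rw [hU i q q hq]
    refine le_trans ?_ (hopt q hq hq0 1 h11 (hxb.le.trans hx.2))
    have h1 : w 1 = 1 := by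
      simp only [hw]
      rw [cdf_one hμ, winProb_one hK]
    rw [h1, mul_one]
    refine sub_le_sub (integral_le_of_forall_le (by positivity) fun θ => topKReward_le hR.le _ _) ?_
    gcongr

theorem mainTheorem3 (N K : ℕ) (hK : 1 ≤ K) (hKN : K < N) (R c : ℝ) (hR : 0 < R) (hc : 0 < c)
    (μ : Measure ℝ) [IsProbabilityMeasure μ] (hμ : HasContinuousDensityOnUnit μ) :
    ∃ b : ℝ → ℝ,
      IsSymmetricPNE N K R c μ b ∧
      (∀ x ∈ Icc (0 : ℝ) 1,
        IsGreatest ((fun s => odeStrategy N K R c μ s - s) '' Icc 0 x)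
          (odeStrategy N K R c μ x - b x)) ∧
      (∀ h : ℝ → ℝ, IsCalibrationOutput (odeStrategy N K R c μ) h →
        IsSymmetricPNE N K R c μ h ∧ EqOn h b (Icc 0 1)) ∧
      ({x ∈ Ioo (0 : ℝ) 1 | deriv (odeStrategy N K R c μ) x = 1}.Finite →
        ∃ h : ℝ → ℝ, IsCalibrationOutput (odeStrategy N K R c μ) h) := by
  obtain ⟨-, hβc, f, -, hf⟩ := exists_hasDerivAt_cdf_odeStrategy N K R c hμ
  have hPNE := isSymmetricPNE_envelope hK hKN hR hc hμ
  refine ⟨envelope (odeStrategy N K R c μ), hPNE, fun x hx => ?_, fun h hh => ?_, fun hfin => ?_⟩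
  · rw [envelope, sub_sub_cancel]
    exact isGreatest_runMax hβc hx
  · have he := hh.eqOn_envelope hβc (odeStrategy_zero N K R c μ)
    exact ⟨hPNE.congr hμ.ae_mem he, he⟩
  · exact exists_isCalibrationOutput hβc (odeStrategy_zero N K R c μ)
      (fun x hx => (hf x hx).2.differentiableAt) hfin
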